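/- **Definitions.** Let $G$ be a finitely generated group, endowed with the word metric $\mathrm{dist}$ of a finite generating set (the notions below do not depend on the choice of this set, except for the value of $M$). * For a non-principal ultrafilter $\omega$ on $\mathbb N$, positive reals $d=(d_n)$ with $\lim_\omega d_n=\infty$ and points $b=(b_n)$ of $G$, the asymptotic cone $\mathrm{Cone}_\omega(G,b,d)$ is the set of sequences $y=(y_n)$ in $G$ with $\lim_\omega \mathrm{dist}(y_n,b_n)/d_n<\infty$, modulo $y\sim z$ iff $\lim_\omega \mathrm{dist}(y_n,z_n)/d_n=0$, with the metric $\lim_\omega \mathrm{dist}(y_n,z_n)/d_n$. A cut-point of a space is a point whose complement is not connected; the point of a one-point space counts as a cut-point. * $G$ is *unconstricted* if (1) there are $\omega$ and $d$ as above such that for every $b$ the cone $\mathrm{Cone}_\omega(G,b,d)$ has no cut-points, and (2) there is a constant $c$ such that every element of $G$ is at distance at most $c$ from a bi-infinite geodesic (an isometric embedding $\mathbb Z\to G$). * A finitely generated subgroup $H\le G$ is *undistorted* if its word metrics are bi-Lipschitz equivalent to the restriction to $H$ of the word metric of $G$. * For $M>0$ and a finite non-empty collection $\mathcal H$ of subgroups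 of $G$, the group $G$ is an *$M$-algebraic network* with respect to $\mathcal H$ if: all $H\in\mathcal H$ are finitely generated and undistorted in $G$; there is a finite index subgroup $G_1\le G$ such that every element of $G$ is at distance less than $M$ from $G_1$ and some finite generating set of $G_1$ is contained in $\bigcup_{H\in\mathcal H}H$; and any $H,H'\in\mathcal H$ are joined by a finite sequence $H=H_1,\dots,H_k=H'$ in $\mathcal H$ with $H_i\cap H_{i+1}$ infinite for all $1\le i<k$. * $G$ is *algebraically thick of order at most $1$* if for some $M>0$ it is an $M$-algebraic network with respect to some finite non-empty collection $\mathcal H$ of unconstricted subgroups. * Let $m_{ij}=m_{ji}\in\{2,3,\dots,\infty\}$ for $i\ne j$ in $\{1,\dots,n\}$. The associated *Artin group* is $A=\langle x_1,\dots,x_n \mid (x_i,x_j)_{m_{ij}}=(x_j,x_i)_{m_{ij}} \text{ for } i\neq j,\ m_{ij}<\infty\rangle$, where $(x,y)_m=xyx\cdots$ ($m$ factors). Its *presentation graph* has vertices $1,\dots,n$, with $i\neq j$ adjacent iff $m_{ij}<\infty$. The Artin group is *even* if every $m_{ij}$ is an even integer or $\infty$. **Theorem.** Every even Artin group with at least two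 generators and connected presentation graph is algebraically thick of order at most $1$. -/

import Mathlib

open Filter Topology

/-! ### Word metrics -/

/-- A finite generating set of a group. -/
structure FinGenSet (G : Type*) [Group G] where
  gens : Finset G
  closure_eq_top : Subgroup.closure (gens : Set G) = ⊤

/-- The word length of `g` with respect to `S`: the least length of a word in the letters of
`S` and their inverses that represents `g`. -/
noncomputable def FinGenSet.length {G : Type*} [Group G] (S : FinGenSet G) (g : G) : ℕ :=
  sInf {n | ∃ l : List G, (∀ s ∈ l, s ∈ S.gens ∨ s⁻¹ ∈ S.gens) ∧ l.prod = g ∧ l.length = n}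

theorem FinGenSet.exists_word {G : Type*} [Group G] (S : FinGenSet G) (g : G) :
    ∃ l : List G, (∀ s ∈ l, s ∈ S.gens ∨ s⁻¹ ∈ S.gens) ∧ l.prod = g ∧ l.length = S.length g := by
  have hne : {n | ∃ l : List G, (∀ s ∈ l, s ∈ S.gens ∨ s⁻¹ ∈ S.gens) ∧ l.prod = g ∧
      l.length = n}.Nonempty := by
    have hg : g ∈ (Subgroup.closure (S.gens : Set G)).toSubmonoid := by
      rw [S.closure_eq_top]; exact Subgroup.mem_top g
    rw [Subgroup.closure_toSubmonoid] at hg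
    obtain ⟨l, hl, hp⟩ := Submonoid.exists_list_of_mem_closure hg
    exact ⟨l.length, l, fun s hs => by simpa using hl s hs, hp, rfl⟩
  exact Nat.sInf_mem hne

theorem FinGenSet.length_le {G : Type*} [Group G] (S : FinGenSet G) (l : List G)
    (hl : ∀ s ∈ l, s ∈ S.gens ∨ s⁻¹ ∈ S.gens) : S.length l.prod ≤ l.length :=
  Nat.sInf_le ⟨l, hl, rfl, rfl⟩

theorem FinGenSet.length_one {G : Type*} [Group G] (S : FinGenSet G) : S.length 1 = 0 := by
  have h := S.length_le [] (by simp)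
  simpa using h

theorem FinGenSet.length_mul_le {G : Type*} [Group G] (S : FinGenSet G) (g h : G) :
    S.length (g * h) ≤ S.length g + S.length h := by
  obtain ⟨l, hl, rfl, hll⟩ := S.exists_word g
  obtain ⟨k, hk, rfl, hkk⟩ := S.exists_word h
  rw [← hll, ← hkk, ← List.prod_append, ← List.length_append]
  refine S.length_le _ fun s hs => ?_
  rcases List.mem_append.1 hs with hs | hs
  · exact hl s hs
  · exact hk s hs

theorem FinGenSet.length_inv_le {G : Type*} [Group G] (S : FinGenSet G) (g : G) :
    S.length g⁻¹ ≤ S.length g := by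
  obtain ⟨l, hl, rfl, hll⟩ := S.exists_word g
  rw [← hll, List.prod_inv_reverse]
  have h := S.length_le (l.map fun x => x⁻¹).reverse (fun s hs => by
    simp only [List.mem_reverse, List.mem_map] at hs
    obtain ⟨t, ht, rfl⟩ := hs
    simpa [or_comm] using hl t ht)
  simpa using h

theorem FinGenSet.length_inv {G : Type*} [Group G] (S : FinGenSet G) (g : G) :
    S.length g⁻¹ = S.length g :=
  le_antisymm (S.length_inv_le g) (by simpa using S.length_inv_le g⁻¹)

theorem FinGenSet.eq_one_of_length {G : Type*} [Group G] (S : FinGenSet G) {g : G}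
    (h : S.length g = 0) : g = 1 := by
  obtain ⟨l, -, rfl, hll⟩ := S.exists_word g
  rw [h, List.length_eq_zero_iff] at hll
  simp [hll]

/-- The underlying set of `G`, regarded as a metric space with the word metric of `S`. -/
def WordSpace {G : Type*} [Group G] (_S : FinGenSet G) : Type _ := G

/-- The word metric `dist g h = |g⁻¹ h|_S`. -/
noncomputable instance {G : Type*} [Group G] (S : FinGenSet G) : MetricSpace (WordSpace S) where
  dist := fun (g h : G) => (S.length (g⁻¹ * h) : ℝ)
  dist_self := fun (g : G) => by
    simp [S.length_one]
  dist_comm := fun (g h : G) => by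
    rw [← S.length_inv (g⁻¹ * h)]
    simp
  dist_triangle := fun (g h k : G) => by
    have := S.length_mul_le (g⁻¹ * h) (h⁻¹ * k)
    rw [show g⁻¹ * h * (h⁻¹ * k) = g⁻¹ * k by group] at this
    exact_mod_cast this
  eq_of_dist_eq_zero := fun {g h : G} hgh => by
    change ((S.length (g⁻¹ * h) : ℕ) : ℝ) = 0 at hgh
    have := S.eq_one_of_length (by exact_mod_cast hgh)
    exact inv_mul_eq_one (G := G).1 this

/-! ### Asymptotic cones -/

/-- A non-principal ultrafilter `ω` on `ℕ`, with a sequence of positive scaling constants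
`d n` such that `lim_ω d n = ∞`. -/
structure ConeScale where
  ω : Ultrafilter ℕ
  nonprincipal : ∀ s ∈ ω, s.Infinite
  d : ℕ → ℝ
  d_pos : ∀ n, 0 < d n
  tendsto_d : Tendsto d ω atTop

/-- The sequences at finite `ω`-distance from the sequence of observation points `b`, where the
metric on the `n`-th factor is `dist / d n`. -/
def PreCone (X : Type*) [MetricSpace X] (σ : ConeScale) (b : ℕ → X) : Type _ :=
  {y : ℕ → X // ∃ C : ℝ, ∀ᶠ n in (σ.ω : Filter ℕ), dist (y n) (b n) / σ.d n ≤ C}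

theorem PreCone.tendsto {X : Type*} [MetricSpace X] {σ : ConeScale} {b : ℕ → X}
    (x y : PreCone X σ b) :
    Tendsto (fun n => dist (x.1 n) (y.1 n) / σ.d n) σ.ω
      (𝓝 (limUnder (σ.ω : Filter ℕ) fun n => dist (x.1 n) (y.1 n) / σ.d n)) := by
  obtain ⟨C, hC⟩ := x.2
  obtain ⟨D, hD⟩ := y.2
  apply tendsto_nhds_limUnder
  have hmem : ∀ᶠ n in (σ.ω : Filter ℕ),
      dist (x.1 n) (y.1 n) / σ.d n ∈ Set.Icc (0 : ℝ) (C + D) := by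
    filter_upwards [hC, hD] with n h1 h2
    have hd := σ.d_pos n
    refine ⟨by positivity, ?_⟩
    calc dist (x.1 n) (y.1 n) / σ.d n
        ≤ (dist (x.1 n) (b n) + dist (y.1 n) (b n)) / σ.d n := by
          gcongr
          exact dist_triangle_right _ _ _
      _ = dist (x.1 n) (b n) / σ.d n + dist (y.1 n) (b n) / σ.d n := add_div _ _ _
      _ ≤ C + D := add_le_add h1 h2
  obtain ⟨a, -, ha⟩ := (isCompact_Icc (a := (0 : ℝ)) (b := C + D)).ultrafilter_le_nhds
    (σ.ω.map fun n => dist (x.1 n) (y.1 n) / σ.d n) (by rw [Filter.le_principal_iff]; exact hmem)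
  exact ⟨a, ha⟩

/-- The pseudo-distance `dist_ω (x, y) = lim_ω dist (x n, y n) / d n`. -/
noncomputable instance {X : Type*} [MetricSpace X] {σ : ConeScale} {b : ℕ → X} :
    PseudoMetricSpace (PreCone X σ b) where
  dist x y := limUnder (σ.ω : Filter ℕ) fun n => dist (x.1 n) (y.1 n) / σ.d n
  dist_self x := by
    have h := PreCone.tendsto x x
    simp only [dist_self, zero_div] at h
    simpa using tendsto_nhds_unique h tendsto_const_nhds
  dist_comm x y := by simp only [dist_comm]
  dist_triangle x y z := by
    refine le_of_tendsto_of_tendsto (PreCone.tendsto x z)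
      ((PreCone.tendsto x y).add (PreCone.tendsto y z)) (Eventually.of_forall fun n => ?_)
    have hd := σ.d_pos n
    change dist (x.1 n) (z.1 n) / σ.d n ≤
      dist (x.1 n) (y.1 n) / σ.d n + dist (y.1 n) (z.1 n) / σ.d n
    rw [← add_div]
    gcongr
    exact dist_triangle _ _ _

/-- The asymptotic cone `Cone_ω (X, b, d)`: sequences at finite `ω`-distance from `b`, modulo
`ω`-distance zero, with the induced metric. -/
abbrev AsymptoticCone (X : Type*) [MetricSpace X] (σ : ConeScale) (b : ℕ → X) : Type _ :=
  SeparationQuotient (PreCone X σ b)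

/-! ### Unconstricted groups -/

/-- `p` is a (global) cut-point of `X`: the complement of `p` is not connected. Since
`IsConnected` includes non-emptiness, the point of a singleton is a cut-point. -/
def IsCutPoint {X : Type*} [TopologicalSpace X] (p : X) : Prop :=
  ¬ IsConnected ({p}ᶜ : Set X)

/-- The group with the word metric of `S` is unconstricted: (1) for some ultrafilter and some
scaling constants, no asymptotic cone, for any choice of observation points, has a cut-point;
(2) every element is at uniformly bounded distance from a bi-infinite geodesic. As the points of
the word metric are the vertices of the Cayley graph, a bi-infinite geodesic is an isometric
embedding of `ℤ` (the sequence of vertices of a bi-infinite geodesic of the Cayley graph). -/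
def FinGenSet.IsUnconstricted {G : Type*} [Group G] (S : FinGenSet G) : Prop :=
  (∃ σ : ConeScale, ∀ b : ℕ → WordSpace S, ∀ p : AsymptoticCone (WordSpace S) σ b,
    ¬ IsCutPoint p) ∧
  (∃ c : ℝ, ∀ x : WordSpace S, ∃ γ : ℤ → WordSpace S, Isometry γ ∧ ∃ k : ℤ, dist x (γ k) ≤ c)

/-- A finitely generated group is unconstricted if it is so for its word metrics. -/
def IsUnconstrictedGroup (G : Type*) [Group G] : Prop :=
  Group.FG G ∧ ∀ S : FinGenSet G, S.IsUnconstricted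

/-! ### Algebraic networks and algebraic thickness -/

/-- `H` is undistorted in `G`: word metrics of `H` are bi-Lipschitz equivalent to restrictions
to `H` of word metrics of `G`. -/
def IsUndistorted {G : Type*} [Group G] (H : Subgroup G) : Prop :=
  ∀ (S : FinGenSet G) (T : FinGenSet H), ∃ L : ℝ, ∀ h h' : H,
    dist (α := WordSpace T) h h' ≤ L * dist (α := WordSpace S) (h : G) (h' : G) ∧
    dist (α := WordSpace S) (h : G) (h' : G) ≤ L * dist (α := WordSpace T) h h'

/-- `G`, with the word metric of `S`, is an `M`-algebraic network with respect to the finite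
non-empty collection `ℋ` of subgroups. -/
structure IsAlgebraicNetwork {G : Type*} [Group G] (S : FinGenSet G) (M : ℝ)
    (ℋ : Set (Subgroup G)) : Prop where
  finite : ℋ.Finite
  nonempty : ℋ.Nonempty
  fg : ∀ H ∈ ℋ, H.FG
  undistorted : ∀ H ∈ ℋ, IsUndistorted H
  exists_finiteIndex : ∃ G₁ : Subgroup G, G₁.FiniteIndex ∧
    (∀ g : G, ∃ h ∈ G₁, dist (α := WordSpace S) g h < M) ∧
    ∃ T : Set G, T.Finite ∧ Subgroup.closure T = G₁ ∧ T ⊆ ⋃ H ∈ ℋ, (H : Set G)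
  thickly_connected : ∀ H ∈ ℋ, ∀ H' ∈ ℋ, Relation.ReflTransGen
    (fun K K' => K ∈ ℋ ∧ K' ∈ ℋ ∧ ((K : Set G) ∩ (K' : Set G)).Infinite) H H'

/-- The group `G` is algebraically thick of order at most `n`. For `n = 0`: `G` is unconstricted.
For `n + 1`: `G` is finitely generated and there is a collection `ℋ` of subgroups, each
algebraically thick of order at most `n`, such that for every word metric on `G` there is `M > 0`
for which `G` is an `M`-algebraic network with respect to `ℋ`. -/
def IsAlgThickOfOrderAtMost : ℕ → (G : Type*) → [Group G] → Prop
  | 0, G, _ => IsUnconstrictedGroup G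
  | n + 1, G, _ => Group.FG G ∧ ∃ ℋ : Set (Subgroup G),
      (∀ S : FinGenSet G, ∃ M : ℝ, 0 < M ∧ IsAlgebraicNetwork S M ℋ) ∧
      ∀ H ∈ ℋ, IsAlgThickOfOrderAtMost n H

/-! ### Artin groups -/

/-- The alternating product `(a, b)_m = a b a ⋯` with `m` factors. -/
def altProd {G : Type*} [Monoid G] : ℕ → G → G → G
  | 0, _, _ => 1
  | m + 1, a, b => a * altProd m b a

/-- The Artin group with labels `m i j`, `i ≠ j`. In Mathlib's `CoxeterMatrix` the label `∞` is
encoded by `0`; then both alternating products are `1` and the relator is trivial. -/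
abbrev ArtinGroup {ι : Type*} (m : CoxeterMatrix ι) : Type _ :=
  PresentedGroup {r : FreeGroup ι | ∃ i j : ι, i ≠ j ∧
    r = altProd (m i j) (FreeGroup.of i) (FreeGroup.of j) *
      (altProd (m j i) (FreeGroup.of j) (FreeGroup.of i))⁻¹}

/-- The Artin presentation graph: `i` and `j` are joined iff `m i j < ∞`. -/
def artinGraph {ι : Type*} (m : CoxeterMatrix ι) : SimpleGraph ι where
  Adj i j := i ≠ j ∧ m i j ≠ 0
  symm := ⟨fun i j h => ⟨h.1.symm, by rw [m.symmetric]; exact h.2⟩⟩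
  loopless := ⟨fun _ h => h.1 rfl⟩

/-- All labels are even integers or `∞` (encoded by the even number `0`). -/
def IsEvenArtin {ι : Type*} (m : CoxeterMatrix ι) : Prop :=
  ∀ i j : ι, i ≠ j → m i j = 0 ∨ Even (m i j)

/-!
Let `H` be generated by two adjacent standard generators `x_i`, `x_j`. As `m i j` is even, the
element `z = (x_i x_j) ^ (m i j / 2)` is central in `H`. There are homomorphisms `φ`, `ψ` from `H`
to `ℝ` with `φ z ≠ 0`, `ψ z = 0` and `ψ ≠ 0`. On an asymptotic cone of `H` they induce Lipschitz
coordinates that vanish at any prescribed point `p`, and right multiplication by powers of `z`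
induces a flow by isometries. This flow preserves the coordinate `ψ` and moves `φ` at a constant
nonzero speed. A point other than `p` can be moved off `{ψ = 0}` without meeting `p`, and the flow
then carries it arbitrarily far away, still avoiding `p`. Two points can therefore be joined in the
complement of `p`: a path between them, translated so far that `φ` is positive along it, misses
`p`. So the cones of `H` have no cut-points, and powers of a suitable generator, on which `ψ` grows
as fast as possible, form bi-infinite geodesics. Hence `H` is unconstricted.

Evenness also makes the map killing all generators except `x_i` and `x_j` a well-defined retraction
onto `H`, so `H` is undistorted. Edges that share a vertex `i` give subgroups that share the
infinite cyclic group generated by `x_i`, so connectedness of the graph makes these subgroups a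
network.
-/

theorem abs_intFloor_sub_intFloor_le {R : Type*} [CommRing R] [LinearOrder R]
    [IsStrictOrderedRing R] [FloorRing R] (u v : R) : |(⌊u⌋ : R) - ⌊v⌋| ≤ |u - v| + 1 := by
  have hu := Int.floor_le u
  have hu' := Int.lt_floor_add_one u
  have hv := Int.floor_le v
  have hv' := Int.lt_floor_add_one v
  rw [abs_le]
  constructor
  · linarith [neg_abs_le (u - v)]
  · linarith [le_abs_self (u - v)]

theorem abs_natFloor_sub_natFloor_le {R : Type*} [CommRing R] [LinearOrder R]
    [IsStrictOrderedRing R] [FloorRing R] (u v : R) : |(⌊u⌋₊ : R) - ⌊v⌋₊| ≤ |u - v| + 1 := by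
  have natFloor_eq_max (w : R) : (⌊w⌋₊ : R) = max (⌊w⌋ : R) 0 := by
    rw [← Int.floor_toNat, ← Int.cast_natCast, Int.toNat_eq_max, Int.cast_max, Int.cast_zero]
  rw [natFloor_eq_max, natFloor_eq_max]
  exact (abs_max_sub_max_le_abs _ _ _).trans (abs_intFloor_sub_intFloor_le u v)

theorem tendsto_intFloor_mul_div_atTop {R : Type*} [Field R] [LinearOrder R]
    [IsStrictOrderedRing R] [TopologicalSpace R] [OrderTopology R] [FloorRing R] (t : R) :
    Tendsto (fun u : R => (⌊t * u⌋ : R) / u) atTop (𝓝 t) := by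
  have hlim : Tendsto (fun u : R => t - 1 / u) atTop (𝓝 t) := by
    simpa using tendsto_const_nhds.sub (tendsto_inv_atTop_zero (𝕜 := R))
  refine tendsto_of_tendsto_of_tendsto_of_le_of_le' hlim tendsto_const_nhds ?_ ?_ <;>
    filter_upwards [eventually_gt_atTop 0] with u hu
  · rw [le_div_iff₀ hu, sub_mul, div_mul_cancel₀ _ hu.ne']
    exact (Int.sub_one_lt_floor _).le
  · exact (div_le_iff₀ hu).2 (Int.floor_le _)

/-! ### Word lengths and Lipschitz maps -/

namespace FinGenSet

variable {G : Type*} [Group G] (S : FinGenSet G)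

theorem length_le_one {s : G} (hs : s ∈ S.gens ∨ s⁻¹ ∈ S.gens) : S.length s ≤ 1 := by
  simpa using S.length_le [s] (by simpa using hs)

/-- The word length as a group seminorm; this makes it directly comparable with other seminorms
on `G`, such as pullbacks of norms under homomorphisms. -/
noncomputable def lengthSeminorm : GroupSeminorm G where
  toFun g := S.length g
  map_one' := by rw [S.length_one, Nat.cast_zero]
  mul_le' g h := by exact_mod_cast S.length_mul_le g h
  inv' g := by rw [S.length_inv]

theorem length_zpow_le (g : G) (k : ℤ) : (S.length (g ^ k) : ℝ) ≤ |(k : ℝ)| * S.length g := by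
  have length_pow_le (n : ℕ) : (S.length (g ^ n) : ℝ) ≤ n * S.length g :=
    letI := S.lengthSeminorm.toSeminormedGroup
    norm_pow_le_mul_norm (a := g)
  obtain ⟨n, rfl | rfl⟩ := k.eq_nat_or_neg
  · simpa using length_pow_le n
  · simpa [S.length_inv] using length_pow_le n

theorem seminorm_le_mul_length (p : GroupSeminorm G) {K : ℝ} (hK : ∀ s ∈ S.gens, p s ≤ K)
    (g : G) : p g ≤ K * S.length g := by
  obtain ⟨l, hl, rfl, hlen⟩ := S.exists_word g
  rw [← hlen]
  clear hlen
  induction l with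
  | nil => simp
  | cons s l ih =>
    have hs : p s ≤ K := (hl s List.mem_cons_self).elim (hK s) fun h => by
      simpa using hK s⁻¹ h
    have hprod := ih fun t ht => hl t (List.mem_cons_of_mem s ht)
    calc p (s :: l).prod ≤ p s + p l.prod := map_mul_le_add p s l.prod
      _ ≤ K + K * l.length := add_le_add hs hprod
      _ = K * (s :: l).length := by rw [List.length_cons]; push_cast; ring

theorem exists_seminorm_le_mul_dist (p : GroupSeminorm G) :
    ∃ K : NNReal, ∀ g h : G, p (g⁻¹ * h) ≤ K * dist (α := WordSpace S) g h := by
  obtain ⟨K, hK⟩ := (S.gens.image p).exists_le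
  exact ⟨K.toNNReal, fun g h => S.seminorm_le_mul_length p
    (fun s hs => (hK _ (Finset.mem_image_of_mem p hs)).trans (Real.le_coe_toNNReal K)) _⟩

theorem exists_lipschitzWith_map {H : Type*} [Group H] (T : FinGenSet H) (f : G →* H) :
    ∃ K, LipschitzWith (α := WordSpace S) (β := WordSpace T) K f := by
  obtain ⟨K, hK⟩ := S.exists_seminorm_le_mul_dist (T.lengthSeminorm.comp f)
  refine ⟨K, LipschitzWith.of_dist_le_mul fun (g h : G) => ?_⟩
  have hgh := hK g h
  rw [GroupSeminorm.comp_apply, map_mul, map_inv] at hgh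
  exact hgh

/-- The powers of a generator on which a nontrivial homomorphism to `ℝ` is largest in absolute
value cannot be shortened. -/
theorem exists_length_zpow_eq_abs {f : G →* Multiplicative ℝ} (hf : f ≠ 1) :
    ∃ s : G, ∀ k : ℤ, (S.length (s ^ k) : ℝ) = |(k : ℝ)| := by
  obtain ⟨a, ha, hfa⟩ : ∃ a ∈ S.gens, f a ≠ 1 := by
    by_contra! h
    exact hf (MonoidHom.eq_of_eqOn_dense S.closure_eq_top h)
  obtain ⟨s, hs, hmax⟩ := S.gens.exists_max_image (fun g => ‖f g‖) ⟨a, ha⟩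
  have hfs : 0 < ‖f s‖ := (norm_pos_iff'.2 hfa).trans_le (hmax a ha)
  refine ⟨s, fun k => le_antisymm ?_ (le_of_mul_le_mul_left ?_ hfs)⟩
  · have hs₁ : (S.length s : ℝ) ≤ 1 := by exact_mod_cast S.length_le_one (.inl hs)
    exact (S.length_zpow_le s k).trans (mul_le_of_le_one_right (abs_nonneg _) hs₁)
  · calc ‖f s‖ * |(k : ℝ)| = ‖f (s ^ k)‖ := by
          rw [map_zpow, ← norm_toAdd (f s ^ k), toAdd_zpow, zsmul_eq_mul, norm_mul, norm_toAdd,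
            Real.norm_eq_abs, mul_comm]
      _ ≤ ‖f s‖ * S.length (s ^ k) :=
          S.seminorm_le_mul_length ((normGroupSeminorm _).comp f) hmax _

end FinGenSet

theorem isUndistorted_of_leftInverse {G : Type*} [Group G] {H : Subgroup G} {r : G →* H}
    (hr : Function.LeftInverse r H.subtype) : IsUndistorted H := by
  intro S T
  obtain ⟨K, hK⟩ := S.exists_lipschitzWith_map T r
  obtain ⟨L, hL⟩ := T.exists_lipschitzWith_map S H.subtype
  have hK' := (hK.weaken (le_max_left K L)).dist_le_mul
  have hL' := (hL.weaken (le_max_right K L)).dist_le_mul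
  refine ⟨(max K L : NNReal), fun h h' => ⟨?_, hL' h h'⟩⟩
  calc dist (α := WordSpace T) h h'
      = dist (α := WordSpace T) (r (H.subtype h)) (r (H.subtype h')) := by rw [hr, hr]
    _ ≤ (max K L : NNReal) * dist (α := WordSpace S) (h : G) (h' : G) := hK' _ _

namespace WordSpace

variable {G : Type*} [Group G] {S : FinGenSet G}

/-- Right multiplication, acting on the points of the word metric. Since the word metric is
left-invariant, these are the maps that move every point by the same bounded amount. -/
def mulRight : WordSpace S → G → WordSpace S := fun (x g : G) => x * g

theorem mulRight_one (x : WordSpace S) : x.mulRight 1 = x := mul_one (M := G) x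

theorem mulRight_mul (x : WordSpace S) (g h : G) :
    x.mulRight (g * h) = (x.mulRight g).mulRight h := (mul_assoc (G := G) x g h).symm

theorem dist_mulRight_self (x : WordSpace S) (g : G) : dist (x.mulRight g) x = S.length g := by
  rw [dist_comm]
  exact congrArg (fun h => (S.length h : ℝ)) (inv_mul_cancel_left (G := G) x g)

theorem dist_mulRight_mulRight (x : WordSpace S) (g h : G) :
    dist (x.mulRight g) (x.mulRight h) = S.length (h⁻¹ * g) := by
  rw [← dist_mulRight_self (x.mulRight h), ← mulRight_mul, mul_inv_cancel_left]

theorem dist_mulRight_zpow_floor_le (x : WordSpace S) (g : G) (u v : ℝ) :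
    dist (x.mulRight (g ^ ⌊u⌋)) (x.mulRight (g ^ ⌊v⌋)) ≤ (|u - v| + 1) * S.length g := by
  rw [dist_mulRight_mulRight, ← zpow_neg, ← zpow_add, neg_add_eq_sub]
  refine (S.length_zpow_le g _).trans ?_
  rw [Int.cast_sub]
  gcongr
  exact abs_intFloor_sub_intFloor_le u v

theorem isometry_mulRight_of_mem_center {z : G} (hz : z ∈ Subgroup.center G) :
    Isometry fun x : WordSpace S => x.mulRight z := by
  refine Isometry.of_dist_eq fun (x y : G) => congrArg (fun g => (S.length g : ℝ)) ?_
  change (x * z)⁻¹ * (y * z) = x⁻¹ * y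
  rw [Subgroup.mem_center_iff.1 hz x, Subgroup.mem_center_iff.1 hz y, mul_inv_rev, mul_assoc,
    inv_mul_cancel_left]

theorem exists_word (x y : WordSpace S) :
    ∃ w : List G, (∀ s ∈ w, s ∈ S.gens ∨ s⁻¹ ∈ S.gens) ∧ x.mulRight w.prod = y ∧
      dist x y = w.length := by
  let x' : G := x
  let y' : G := y
  obtain ⟨w, hw, hprod, hlen⟩ := S.exists_word (x'⁻¹ * y')
  exact ⟨w, hw, hprod ▸ mul_inv_cancel_left x' y', congrArg Nat.cast hlen.symm⟩

theorem exists_lipschitzWith_geodesic (x y : WordSpace S) :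
    ∃ γ : ℕ → WordSpace S, LipschitzWith 1 γ ∧ γ 0 = x ∧ γ ⌈dist x y⌉₊ = y := by
  obtain ⟨w, hw, hprod, hdist⟩ := x.exists_word y
  have hstep (i : ℕ) :
      dist (x.mulRight (w.take i).prod) (x.mulRight (w.take (i + 1)).prod) ≤ 1 := by
    rw [dist_comm]
    rcases lt_or_ge i w.length with hi | hi
    · rw [List.prod_take_succ _ _ hi, dist_mulRight_mulRight, inv_mul_cancel_left]
      exact_mod_cast S.length_le_one (hw _ (List.getElem_mem hi))
    · rw [List.take_of_length_le hi, List.take_of_length_le (hi.trans i.le_succ), dist_self]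
      exact zero_le_one
  refine ⟨fun i => x.mulRight (w.take i).prod, LipschitzWith.of_dist_le_mul fun i j => ?_,
    x.mulRight_one, ?_⟩
  · wlog hij : i ≤ j generalizing i j
    · rw [dist_comm, dist_comm i]
      exact this j i (le_of_not_ge hij)
    refine (dist_le_Ico_sum_of_dist_le (f := fun i => x.mulRight (w.take i).prod) hij
      fun _ _ => hstep _).trans ?_
    rw [Finset.sum_const, Nat.card_Ico, nsmul_one, Nat.cast_sub hij, NNReal.coe_one, one_mul,
      dist_comm, Nat.dist_eq]
    exact le_abs_self _
  · dsimp only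
    rw [hdist, Nat.ceil_natCast, List.take_length, hprod]

theorem exists_isometry_int {f : G →* Multiplicative ℝ} (hf : f ≠ 1) (x : WordSpace S) :
    ∃ γ : ℤ → WordSpace S, Isometry γ ∧ γ 0 = x := by
  obtain ⟨s, hs⟩ := S.exists_length_zpow_eq_abs hf
  refine ⟨fun k => x.mulRight (s ^ k), Isometry.of_dist_eq fun k l => ?_, ?_⟩
  · rw [dist_mulRight_mulRight, ← zpow_neg, ← zpow_add, neg_add_eq_sub, hs, Int.dist_eq,
      Int.cast_sub]
  · dsimp only
    rw [zpow_zero, mulRight_one]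

/-- A homomorphism to `ℝ`, regarded as a function on the points of the word metric. -/
def height (f : G →* Multiplicative ℝ) : WordSpace S → ℝ := fun (x : G) => (f x).toAdd

theorem height_mulRight (f : G →* Multiplicative ℝ) (x : WordSpace S) (g : G) :
    height f (x.mulRight g) = height f x + (f g).toAdd :=
  congrArg Multiplicative.toAdd (f.map_mul x g)

theorem exists_lipschitzWith_height (S : FinGenSet G) (f : G →* Multiplicative ℝ) :
    ∃ K, LipschitzWith K (height f : WordSpace S → ℝ) := by
  obtain ⟨K, hK⟩ := S.exists_seminorm_le_mul_dist ((normGroupSeminorm _).comp f)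
  refine ⟨K, LipschitzWith.of_dist_le_mul fun (x y : G) => ?_⟩
  calc |(f x).toAdd - (f y).toAdd| = ‖f (x⁻¹ * y)‖ := by
        rw [map_mul, map_inv, ← norm_toAdd, toAdd_mul, toAdd_inv, neg_add_eq_sub, abs_sub_comm,
          Real.norm_eq_abs]
    _ ≤ K * dist (α := WordSpace S) x y := hK x y

end WordSpace

/-! ### Paths and translation flows in asymptotic cones -/

theorem ConeScale.tendsto_const_div (σ : ConeScale) (C : ℝ) :
    Tendsto (fun n => C / σ.d n) σ.ω (𝓝 0) :=
  tendsto_const_nhds.div_atTop σ.tendsto_d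

namespace PreCone

section Metric

variable {X : Type*} [MetricSpace X] {σ : ConeScale} {b : ℕ → X}

theorem eventually_dist_le (x y : PreCone X σ b) :
    ∀ᶠ n in (σ.ω : Filter ℕ), dist (x.1 n) (y.1 n) ≤ (dist x y + 1) * σ.d n := by
  filter_upwards [(PreCone.tendsto x y).eventually_le_const (lt_add_one (dist x y))] with n hn
  exact (div_le_iff₀ (σ.d_pos n)).1 hn

theorem dist_le_of_eventually {x y : PreCone X σ b} {K C : ℝ}
    (h : ∀ᶠ n in (σ.ω : Filter ℕ), dist (x.1 n) (y.1 n) ≤ K * σ.d n + C) : dist x y ≤ K := by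
  have hlim : Tendsto (fun n => K + C / σ.d n) σ.ω (𝓝 K) := by
    simpa using tendsto_const_nhds.add (σ.tendsto_const_div C)
  refine le_of_tendsto_of_tendsto (PreCone.tendsto x y) hlim ?_
  filter_upwards [h] with n hn
  rw [div_le_iff₀ (σ.d_pos n), add_mul, div_mul_cancel₀ _ (σ.d_pos n).ne']
  exact hn

theorem exists_dist_div_le (x : PreCone X σ b) {y : ℕ → X} {K C : ℝ}
    (h : ∀ᶠ n in (σ.ω : Filter ℕ), dist (y n) (x.1 n) ≤ K * σ.d n + C) :
    ∃ D : ℝ, ∀ᶠ n in (σ.ω : Filter ℕ), dist (y n) (b n) / σ.d n ≤ D := by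
  obtain ⟨B, hB⟩ := x.2
  refine ⟨K + 1 + B, ?_⟩
  filter_upwards [h, hB, (σ.tendsto_const_div C).eventually_le_const one_pos] with n hy hx hC
  have hd := σ.d_pos n
  rw [div_le_iff₀ hd] at hx hC ⊢
  linarith [dist_triangle (y n) (x.1 n) (b n)]

/-- The paths are limits of the given discrete geodesics, parametrised proportionally to length. -/
theorem joined_of_geodesics
    (hX : ∀ x y : X, ∃ γ : ℕ → X, LipschitzWith 1 γ ∧ γ 0 = x ∧ γ ⌈dist x y⌉₊ = y)
    (x y : PreCone X σ b) : Joined x y := by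
  choose γ hγ hγ₀ hγ₁ using fun n => hX (x.1 n) (y.1 n)
  set N : ℕ → ℕ := fun n => ⌈dist (x.1 n) (y.1 n)⌉₊
  have dist_path_le : ∀ᶠ n in (σ.ω : Filter ℕ), ∀ s t : ℝ,
      dist (γ n ⌊s * N n⌋₊) (γ n ⌊t * N n⌋₊) ≤
        (dist x y + 1) * |s - t| * σ.d n + (|s - t| + 1) := by
    filter_upwards [x.eventually_dist_le y] with n hn s t
    have hN : (N n : ℝ) ≤ (dist x y + 1) * σ.d n + 1 :=
      (Nat.ceil_lt_add_one dist_nonneg).le.trans (by gcongr)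
    calc dist (γ n ⌊s * N n⌋₊) (γ n ⌊t * N n⌋₊)
        ≤ |(⌊s * N n⌋₊ : ℝ) - ⌊t * N n⌋₊| := by
          simpa [Nat.dist_eq] using (hγ n).dist_le_mul _ _
      _ ≤ |s * N n - t * N n| + 1 := abs_natFloor_sub_natFloor_le _ _
      _ = |s - t| * N n + 1 := by rw [← sub_mul, abs_mul, Nat.abs_cast]
      _ ≤ |s - t| * ((dist x y + 1) * σ.d n + 1) + 1 := by gcongr
      _ = (dist x y + 1) * |s - t| * σ.d n + (|s - t| + 1) := by ring
  let F (t : ℝ) : PreCone X σ b := ⟨fun n => γ n ⌊t * N n⌋₊, x.exists_dist_div_le <| by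
    filter_upwards [dist_path_le] with n hn
    simpa [hγ₀] using hn t 0⟩
  have hF : LipschitzWith (Real.toNNReal (dist x y + 1)) F := by
    refine LipschitzWith.of_dist_le' fun s t => dist_le_of_eventually (C := |s - t| + 1) ?_
    filter_upwards [dist_path_le] with n hn using hn s t
  refine joinedIn_univ.1 (JoinedIn.ofLine hF.continuous.continuousOn ?_ ?_ (Set.subset_univ _))
  · exact Subtype.ext (funext fun n => by simp [F, hγ₀])
  · exact Subtype.ext (funext fun n => by simp [F, N, hγ₁])

/-- The coordinate function on the cone induced by `h : X → ℝ`, normalised to vanish at `p`. It is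
meaningful for Lipschitz `h`; otherwise the limit need not exist. -/
noncomputable def coord (h : X → ℝ) (p x : PreCone X σ b) : ℝ :=
  limUnder (σ.ω : Filter ℕ) fun n => (h (x.1 n) - h (p.1 n)) / σ.d n

theorem coord_self (h : X → ℝ) (p : PreCone X σ b) : coord h p p = 0 := by
  simpa [coord] using (tendsto_const_nhds (x := (0 : ℝ)) (f := (σ.ω : Filter ℕ))).limUnder_eq

variable {h : X → ℝ} {K : NNReal}

theorem tendsto_coord (hh : LipschitzWith K h) (p x : PreCone X σ b) :
    Tendsto (fun n => (h (x.1 n) - h (p.1 n)) / σ.d n) σ.ω (𝓝 (coord h p x)) := by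
  apply tendsto_nhds_limUnder
  have hmem : ∀ᶠ n in (σ.ω : Filter ℕ), (h (x.1 n) - h (p.1 n)) / σ.d n ∈
      Metric.closedBall 0 (K * (dist x p + 1)) := by
    filter_upwards [x.eventually_dist_le p] with n hn
    have hd := σ.d_pos n
    rw [mem_closedBall_zero_iff, norm_div, Real.norm_of_nonneg hd.le, div_le_iff₀ hd, mul_assoc,
      ← dist_eq_norm]
    exact (hh.dist_le_mul _ _).trans (by gcongr)
  obtain ⟨a, -, ha⟩ := (isCompact_closedBall _ _).ultrafilter_le_nhds
    (σ.ω.map fun n => (h (x.1 n) - h (p.1 n)) / σ.d n) (le_principal_iff.2 hmem)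
  exact ⟨a, ha⟩

theorem lipschitzWith_coord (hh : LipschitzWith K h) (p : PreCone X σ b) :
    LipschitzWith K (coord h p) := by
  refine LipschitzWith.of_dist_le_mul fun x y => ?_
  refine le_of_tendsto_of_tendsto ((tendsto_coord hh p x).dist (tendsto_coord hh p y))
    ((PreCone.tendsto x y).const_mul (K : ℝ)) (Eventually.of_forall fun n => ?_)
  have hd := σ.d_pos n
  dsimp only
  rw [Real.dist_eq, ← sub_div, sub_sub_sub_cancel_right, abs_div, abs_of_pos hd, ← mul_div_assoc]
  gcongr
  exact hh.dist_le_mul _ _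

theorem not_inseparable_of_coord_ne_zero (hh : LipschitzWith K h) {p x : PreCone X σ b}
    (hx : coord h p x ≠ 0) : ¬ Inseparable p x := fun hpx =>
  hx ((hpx.map (lipschitzWith_coord hh p).continuous).eq.symm.trans (coord_self h p))

end Metric

section Group

open WordSpace

variable {G : Type*} [Group G] {S : FinGenSet G} {σ : ConeScale} {b : ℕ → WordSpace S}

/-- The time-`t` map `[x_n] ↦ [x_n g ^ ⌊t d_n⌋]` of the flow along `g`. It is a flow up to
inseparability only, because of the rounding. -/
noncomputable def translate (g : G) (t : ℝ) (x : PreCone (WordSpace S) σ b) :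
    PreCone (WordSpace S) σ b :=
  ⟨fun n => (x.1 n).mulRight (g ^ ⌊t * σ.d n⌋),
    x.exists_dist_div_le (K := |t| * S.length g) (C := S.length g) <| .of_forall fun n => by
      have hdist := dist_mulRight_zpow_floor_le (x.1 n) g (t * σ.d n) 0
      rw [Int.floor_zero, zpow_zero, mulRight_one, sub_zero, abs_mul, abs_of_pos (σ.d_pos n)]
        at hdist
      linarith⟩

theorem translate_zero (g : G) (x : PreCone (WordSpace S) σ b) : translate g 0 x = x :=
  Subtype.ext <| funext fun n => by simp [translate, mulRight_one]

theorem lipschitzWith_translate (g : G) (x : PreCone (WordSpace S) σ b) :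
    LipschitzWith (S.length g) fun t => translate g t x := by
  refine LipschitzWith.of_dist_le_mul fun s t =>
    dist_le_of_eventually (C := S.length g) (.of_forall fun n => ?_)
  refine (dist_mulRight_zpow_floor_le (x.1 n) g (s * σ.d n) (t * σ.d n)).trans_eq ?_
  rw [← sub_mul, abs_mul, abs_of_pos (σ.d_pos n), Real.dist_eq, NNReal.coe_natCast]
  ring

theorem isometry_translate {z : G} (hz : z ∈ Subgroup.center G) (t : ℝ) :
    Isometry (translate (σ := σ) (b := b) z t) :=
  Isometry.of_dist_eq fun x y => congrArg (limUnder σ.ω) <| funext fun n =>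
    congrArg (· / σ.d n) <|
      (isometry_mulRight_of_mem_center (zpow_mem hz _)).dist_eq (x.1 n) (y.1 n)

theorem coord_translate (f : G →* Multiplicative ℝ) (g : G) (t : ℝ)
    (p x : PreCone (WordSpace S) σ b) :
    coord (height f) p (translate g t x) = coord (height f) p x + t * (f g).toAdd := by
  obtain ⟨K, hK⟩ := exists_lipschitzWith_height S f
  refine tendsto_nhds_unique (tendsto_coord hK p (translate g t x)) ?_
  have hfloor := (tendsto_intFloor_mul_div_atTop t).comp σ.tendsto_d
  refine ((tendsto_coord hK p x).add (hfloor.mul_const _)).congr fun n => ?_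
  change _ = (height f ((x.1 n).mulRight (g ^ ⌊t * σ.d n⌋)) - _) / _
  rw [Function.comp_apply, height_mulRight, map_zpow, toAdd_zpow, zsmul_eq_mul]
  ring

theorem exists_joinedIn_coord_ne_zero {f : G →* Multiplicative ℝ} {g : G} (hg : f g ≠ 1)
    {p x : PreCone (WordSpace S) σ b} (hx : ¬ Inseparable p x) :
    ∃ y, coord (height f) p y ≠ 0 ∧ JoinedIn {q | ¬ Inseparable p q} x y := by
  by_cases hcoord : coord (height f) p x = 0
  swap
  · exact ⟨x, hcoord, JoinedIn.refl hx⟩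
  have coord_ne_zero {t : ℝ} (ht : t ≠ 0) : coord (height f) p (translate g t x) ≠ 0 := by
    rw [coord_translate, hcoord, zero_add]
    exact mul_ne_zero ht (toAdd_eq_zero.not.2 hg)
  obtain ⟨K, hK⟩ := exists_lipschitzWith_height S f
  refine ⟨translate g 1 x, coord_ne_zero one_ne_zero, JoinedIn.ofLine
    (lipschitzWith_translate g x).continuous.continuousOn (translate_zero g x) rfl ?_⟩
  rintro _ ⟨t, -, rfl⟩
  rcases eq_or_ne t 0 with rfl | ht
  · change ¬ Inseparable p (translate g 0 x)
    rwa [translate_zero]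
  · exact not_inseparable_of_coord_ne_zero hK (coord_ne_zero ht)

theorem joinedIn_translate {f : G →* Multiplicative ℝ} {z : G} (hz : f z = 1)
    {p x : PreCone (WordSpace S) σ b} (hx : coord (height f) p x ≠ 0) (t : ℝ) :
    JoinedIn {q | ¬ Inseparable p q} x (translate z t x) := by
  obtain ⟨K, hK⟩ := exists_lipschitzWith_height S f
  have hcont : Continuous fun s => translate z (s * t) x :=
    (lipschitzWith_translate z x).continuous.comp (continuous_mul_const t)
  refine JoinedIn.ofLine hcont.continuousOn ?_ ?_ ?_
  · rw [zero_mul, translate_zero]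
  · rw [one_mul]
  · rintro _ ⟨s, -, rfl⟩
    apply not_inseparable_of_coord_ne_zero hK
    rwa [coord_translate, hz, toAdd_one, mul_zero, add_zero]

theorem exists_joinedIn_translate_translate {f : G →* Multiplicative ℝ} {z : G}
    (hz : z ∈ Subgroup.center G) (hfz : f z ≠ 1) (p x y : PreCone (WordSpace S) σ b) :
    ∃ t, JoinedIn {q | ¬ Inseparable p q} (translate z t x) (translate z t y) := by
  obtain ⟨K, hK⟩ := exists_lipschitzWith_height S f
  obtain ⟨γ⟩ := joined_of_geodesics exists_lipschitzWith_geodesic x y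
  obtain ⟨B, hB⟩ := isCompact_univ.exists_bound_of_continuousOn
    ((lipschitzWith_coord hK p).continuous.comp γ.continuous).continuousOn
  refine ⟨(B + 1) / (f z).toAdd, γ.map (isometry_translate hz _).continuous, fun s =>
    not_inseparable_of_coord_ne_zero hK ?_⟩
  rw [Path.map_coe, Function.comp_apply, coord_translate,
    div_mul_cancel₀ _ (toAdd_eq_zero.not.2 hfz)]
  have hbound : -B ≤ coord (height f) p (γ s) := neg_le_of_abs_le (hB s (Set.mem_univ s))
  linarith

theorem isPathConnected_setOf_not_inseparable {φ ψ : G →* Multiplicative ℝ} {z : G}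
    (hz : z ∈ Subgroup.center G) (hφ : φ z ≠ 1) (hψz : ψ z = 1) (hψ : ψ ≠ 1)
    (p : PreCone (WordSpace S) σ b) : IsPathConnected {q | ¬ Inseparable p q} := by
  rw [isPathConnected_iff]
  constructor
  · obtain ⟨K, hK⟩ := exists_lipschitzWith_height S φ
    refine ⟨translate z 1 p, not_inseparable_of_coord_ne_zero hK ?_⟩
    rw [coord_translate, coord_self, zero_add, one_mul]
    exact toAdd_eq_zero.not.2 hφ
  · intro x hx y hy
    obtain ⟨g, hg⟩ := DFunLike.ne_iff.1 hψ
    obtain ⟨x', hx', hxx'⟩ := exists_joinedIn_coord_ne_zero hg hx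
    obtain ⟨y', hy', hyy'⟩ := exists_joinedIn_coord_ne_zero hg hy
    obtain ⟨t, ht⟩ := exists_joinedIn_translate_translate hz hφ p x' y'
    exact hxx'.trans <| (joinedIn_translate hψz hx' t).trans <| ht.trans <|
      (joinedIn_translate hψz hy' t).symm.trans hyy'.symm

end Group

end PreCone

theorem AsymptoticCone.not_isCutPoint {G : Type*} [Group G] {S : FinGenSet G} {σ : ConeScale}
    {b : ℕ → WordSpace S} {φ ψ : G →* Multiplicative ℝ} {z : G}
    (hz : z ∈ Subgroup.center G) (hφ : φ z ≠ 1) (hψz : ψ z = 1) (hψ : ψ ≠ 1)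
    (p : AsymptoticCone (WordSpace S) σ b) : ¬ IsCutPoint p := by
  obtain ⟨p, rfl⟩ := SeparationQuotient.surjective_mk p
  rw [IsCutPoint, not_not]
  have hcompl : {q | ¬ Inseparable p q} =
      SeparationQuotient.mk ⁻¹' {SeparationQuotient.mk p}ᶜ := by
    ext q
    exact (SeparationQuotient.mk_eq_mk.symm.trans eq_comm).not
  have himage := (PreCone.isPathConnected_setOf_not_inseparable hz hφ hψz hψ p).image
    SeparationQuotient.continuous_mk
  rw [hcompl, Set.image_preimage_eq _ SeparationQuotient.surjective_mk] at himage
  exact himage.isConnected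

theorem ConeScale.nonempty : Nonempty ConeScale :=
  ⟨{ ω := hyperfilter ℕ
     nonprincipal := fun _ hs hfin =>
       (hyperfilter ℕ).compl_notMem_iff.2 hs (compl_mem_hyperfilter_of_finite hfin)
     d := fun n => n + 1
     d_pos := fun n => n.cast_add_one_pos
     tendsto_d := (tendsto_atTop_add_const_right _ _ tendsto_natCast_atTop_atTop).mono_left
       Nat.hyperfilter_le_atTop }⟩

theorem isUnconstrictedGroup_of_mem_center {G : Type*} [Group G] [Group.FG G]
    {φ ψ : G →* Multiplicative ℝ} {z : G} (hz : z ∈ Subgroup.center G) (hφ : φ z ≠ 1)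
    (hψz : ψ z = 1) (hψ : ψ ≠ 1) : IsUnconstrictedGroup G := by
  refine ⟨‹_›, fun S => ⟨?_, 0, fun x => ?_⟩⟩
  · obtain ⟨σ⟩ := ConeScale.nonempty
    exact ⟨σ, fun _ => AsymptoticCone.not_isCutPoint hz hφ hψz hψ⟩
  · obtain ⟨γ, hγ, hγ₀⟩ := WordSpace.exists_isometry_int hψ x
    exact ⟨γ, hγ, 0, by rw [hγ₀, dist_self]⟩

/-! ### Even Artin groups -/

theorem altProd_of_even {G : Type*} [Monoid G] {k : ℕ} (hk : Even k) (a b : G) :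
    altProd k a b = (a * b) ^ (k / 2) := by
  obtain ⟨n, rfl⟩ := even_iff_exists_two_mul.1 hk
  rw [Nat.mul_div_cancel_left n two_pos]
  induction n with
  | zero => exact (pow_zero _).symm
  | succ n ih =>
    change a * (b * altProd (2 * n) a b) = _
    rw [ih (even_two_mul n), pow_succ', mul_assoc]

theorem map_altProd {G H : Type*} [Monoid G] [Monoid H] (f : G →* H) (k : ℕ) (a b : G) :
    f (altProd k a b) = altProd k (f a) (f b) := by
  induction k generalizing a b with
  | zero => exact map_one f
  | succ k ih => exact (map_mul f _ _).trans (congrArg (f a * ·) (ih b a))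

theorem commute_mul_pow_of_mem_closure_pair {G : Type*} [Group G] {a b g : G} {k : ℕ}
    (h : (a * b) ^ k = (b * a) ^ k) (hg : g ∈ Subgroup.closure {a, b}) :
    Commute g ((a * b) ^ k) := by
  have hle : Subgroup.closure {a, b} ≤ Subgroup.centralizer {(a * b) ^ k} := by
    rw [Subgroup.closure_le]
    rintro x (rfl | rfl) <;> rw [SetLike.mem_coe, Subgroup.mem_centralizer_singleton_iff]
    · rw [mul_pow_mul, h]
    · rw [h, mul_pow_mul, h]
  exact Subgroup.mem_centralizer_singleton_iff.1 (hle hg)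

theorem IsEvenArtin.even {ι : Type*} {m : CoxeterMatrix ι} (heven : IsEvenArtin m) {i j : ι}
    (hij : i ≠ j) : Even (m i j) :=
  (heven i j hij).elim (fun h => h ▸ Even.zero) id

namespace ArtinGroup

variable {ι : Type*} (m : CoxeterMatrix ι)

/-- The standard generator `x_i`. -/
def gen (i : ι) : ArtinGroup m := PresentedGroup.of i

theorem closure_range_gen : Subgroup.closure (Set.range (gen m)) = ⊤ :=
  PresentedGroup.closure_range_of _

theorem altProd_gen {i j : ι} (hij : i ≠ j) :
    altProd (m i j) (gen m i) (gen m j) = altProd (m i j) (gen m j) (gen m i) := by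
  have hrel := PresentedGroup.mk_eq_mk_of_mul_inv_mem (rels := {r : FreeGroup ι | ∃ i j : ι,
    i ≠ j ∧ r = altProd (m i j) (FreeGroup.of i) (FreeGroup.of j) *
      (altProd (m j i) (FreeGroup.of j) (FreeGroup.of i))⁻¹}) ⟨i, j, hij, rfl⟩
  rwa [map_altProd, map_altProd, m.symmetric j i] at hrel

variable {m}

theorem mul_gen_pow_eq (heven : IsEvenArtin m) {i j : ι} (hij : i ≠ j) :
    (gen m i * gen m j) ^ (m i j / 2) = (gen m j * gen m i) ^ (m i j / 2) := by
  simpa only [altProd_of_even (heven.even hij)] using altProd_gen m hij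

/-- The universal property of the Artin presentation. -/
def lift {G : Type*} [Group G] (f : ι → G)
    (hf : ∀ i j, i ≠ j → altProd (m i j) (f i) (f j) = altProd (m i j) (f j) (f i)) :
    ArtinGroup m →* G :=
  PresentedGroup.toGroup (f := f) <| by
    rintro r ⟨i, j, hij, rfl⟩
    rw [map_mul, map_inv, map_altProd, map_altProd, FreeGroup.lift_apply_of,
      FreeGroup.lift_apply_of, m.symmetric j i, hf i j hij, mul_inv_cancel]

theorem lift_gen {G : Type*} [Group G] {f : ι → G}
    (hf : ∀ i j, i ≠ j → altProd (m i j) (f i) (f j) = altProd (m i j) (f j) (f i)) (i : ι) :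
    lift f hf (gen m i) = f i :=
  PresentedGroup.toGroup.of _

variable (m) in
/-- The exponent-sum homomorphism, with values in `ℝ` so that it yields a coordinate on asymptotic
cones. -/
noncomputable def exponentSum : ArtinGroup m →* Multiplicative ℝ :=
  lift (fun _ => Multiplicative.ofAdd 1) fun _ _ _ => rfl

theorem exponentSum_gen (i : ι) : exponentSum m (gen m i) = Multiplicative.ofAdd 1 :=
  lift_gen _ i

/-- Even Artin groups have no relations between the exponents of different generators, so any
values on the generators extend to a homomorphism to a commutative group. -/
def liftComm (heven : IsEvenArtin m) {A : Type*} [CommGroup A] (f : ι → A) : ArtinGroup m →* A :=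
  lift f fun i j hij => by
    rw [altProd_of_even (heven.even hij), altProd_of_even (heven.even hij), mul_comm]

theorem liftComm_gen (heven : IsEvenArtin m) {A : Type*} [CommGroup A] (f : ι → A) (i : ι) :
    liftComm heven f (gen m i) = f i :=
  lift_gen _ i

theorem not_isOfFinOrder_gen (i : ι) : ¬ IsOfFinOrder (gen m i) := fun hi => by
  have hone := (exponentSum m).isOfFinOrder hi
  rw [exponentSum_gen, isOfFinOrder_ofAdd_iff, isOfFinAddOrder_iff_eq_zero] at hone
  exact one_ne_zero hone

variable (m) in
/-- The standard parabolic subgroup generated by the `x_i` with `i ∈ T`. -/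
def standardParabolic (T : Set ι) : Subgroup (ArtinGroup m) := Subgroup.closure (gen m '' T)

theorem standardParabolic_pair (i j : ι) :
    standardParabolic m {i, j} = Subgroup.closure {gen m i, gen m j} := by
  rw [standardParabolic, Set.image_pair]

theorem gen_mem_standardParabolic {T : Set ι} {i : ι} (hi : i ∈ T) :
    gen m i ∈ standardParabolic m T :=
  Subgroup.subset_closure (Set.mem_image_of_mem _ hi)

theorem gen_mem_standardParabolic_pair_left (i j : ι) : gen m i ∈ standardParabolic m {i, j} :=
  gen_mem_standardParabolic (Set.mem_insert i {j})

theorem gen_mem_standardParabolic_pair_right (i j : ι) : gen m j ∈ standardParabolic m {i, j} :=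
  gen_mem_standardParabolic (Set.mem_insert_of_mem i rfl)

theorem fg_standardParabolic {T : Set ι} (hT : T.Finite) : (standardParabolic m T).FG :=
  (Subgroup.fg_iff _).2 ⟨_, rfl, hT.image _⟩

/-- Killing the generators outside `T` respects the relations, because both sides of a relation
of even length contain each of the two generators equally often. -/
theorem exists_leftInverse_subtype (heven : IsEvenArtin m) (T : Set ι) :
    ∃ r : ArtinGroup m →* standardParabolic m T,
      Function.LeftInverse r (standardParabolic m T).subtype := by
  classical
  let f (k : ι) : standardParabolic m T :=
    if hk : k ∈ T then ⟨gen m k, gen_mem_standardParabolic hk⟩ else 1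
  have hf (i j : ι) (hij : i ≠ j) :
      altProd (m i j) (f i) (f j) = altProd (m i j) (f j) (f i) := by
    rw [altProd_of_even (heven.even hij), altProd_of_even (heven.even hij)]
    by_cases hi : i ∈ T
    · by_cases hj : j ∈ T
      · simp only [f, dif_pos hi, dif_pos hj]
        exact Subtype.ext (mul_gen_pow_eq heven hij)
      · simp only [f, dif_neg hj, mul_one, one_mul]
    · simp only [f, dif_neg hi, mul_one, one_mul]
  have hfix : Set.EqOn ((standardParabolic m T).subtype.comp (lift f hf))
      (MonoidHom.id (ArtinGroup m)) (gen m '' T) := by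
    rintro _ ⟨k, hk, rfl⟩
    rw [MonoidHom.comp_apply, lift_gen, MonoidHom.id_apply]
    simp only [f, dif_pos hk, Subgroup.subtype_apply]
  exact ⟨lift f hf, fun h => Subtype.ext (MonoidHom.eqOn_closure hfix h.2)⟩

theorem isUnconstrictedGroup_standardParabolic_pair (heven : IsEvenArtin m) {i j : ι}
    (hij : (artinGraph m).Adj i j) : IsUnconstrictedGroup (standardParabolic m {i, j}) := by
  classical
  have hfg := (Group.fg_iff_subgroup_fg _).2 (fg_standardParabolic (m := m) (Set.toFinite {i, j}))
  let H := standardParabolic m {i, j}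
  let z : H := ⟨gen m i * gen m j, mul_mem (gen_mem_standardParabolic_pair_left i j)
    (gen_mem_standardParabolic_pair_right i j)⟩ ^ (m i j / 2)
  have hz : z ∈ Subgroup.center H := Subgroup.mem_center_iff.2 fun g => Subtype.ext <|
    commute_mul_pow_of_mem_closure_pair (mul_gen_pow_eq heven hij.1)
      ((standardParabolic_pair i j).le g.2)
  let ψ := liftComm heven fun k => Multiplicative.ofAdd (if k = i then (1 : ℝ) else -1)
  have hψi : ψ (gen m i) = Multiplicative.ofAdd 1 := by rw [liftComm_gen, if_pos rfl]
  have hψj : ψ (gen m j) = Multiplicative.ofAdd (-1) := by rw [liftComm_gen, if_neg hij.1.symm]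
  refine isUnconstrictedGroup_of_mem_center (φ := (exponentSum m).comp H.subtype)
    (ψ := ψ.comp H.subtype) hz ?_ ?_ ?_
  · have hpos : m i j / 2 ≠ 0 := by
      obtain ⟨k, hk⟩ := heven.even hij.1
      have hlabel := hij.2
      lia
    change exponentSum m ((gen m i * gen m j) ^ (m i j / 2)) ≠ 1
    rw [map_pow, map_mul, exponentSum_gen, exponentSum_gen, ← ofAdd_add,
      ← ofAdd_nsmul, ne_eq, ofAdd_eq_one]
    exact smul_ne_zero hpos (by norm_num)
  · change ψ ((gen m i * gen m j) ^ (m i j / 2)) = 1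
    rw [map_pow, map_mul, hψi, hψj, ← ofAdd_add, add_neg_cancel, ofAdd_zero, one_pow]
  · refine DFunLike.ne_iff.2 ⟨⟨gen m i, gen_mem_standardParabolic_pair_left i j⟩, ?_⟩
    change ψ (gen m i) ≠ 1
    rw [hψi]
    exact ofAdd_eq_one.not.2 one_ne_zero

theorem infinite_inter_of_gen_mem {i : ι} {H K : Subgroup (ArtinGroup m)} (hH : gen m i ∈ H)
    (hK : gen m i ∈ K) : ((H : Set (ArtinGroup m)) ∩ K).Infinite :=
  (infinite_zpowers.2 (not_isOfFinOrder_gen i)).mono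
    (Set.subset_inter (Subgroup.zpowers_le.2 hH) (Subgroup.zpowers_le.2 hK))

variable (m) in
/-- The subgroups generated by two adjacent standard generators; they form the collection with
respect to which an even Artin group is an algebraic network. -/
def edgeSubgroups : Set (Subgroup (ArtinGroup m)) :=
  {H | ∃ i j, (artinGraph m).Adj i j ∧ H = standardParabolic m {i, j}}

theorem reflTransGen_edgeSubgroups {j k : ι} (hjk : (artinGraph m).Reachable j k) {i l : ι}
    (hij : (artinGraph m).Adj i j) (hkl : (artinGraph m).Adj k l) :
    Relation.ReflTransGen
      (fun K K' => K ∈ edgeSubgroups m ∧ K' ∈ edgeSubgroups m ∧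
        ((K : Set (ArtinGroup m)) ∩ (K' : Set (ArtinGroup m))).Infinite)
      (standardParabolic m {i, j}) (standardParabolic m {k, l}) := by
  have infinite_inter (i j l : ι) :
      ((standardParabolic m {i, j} : Set (ArtinGroup m)) ∩ standardParabolic m {j, l}).Infinite :=
    infinite_inter_of_gen_mem (gen_mem_standardParabolic_pair_right i j)
      (gen_mem_standardParabolic_pair_left j l)
  obtain ⟨w⟩ := hjk
  induction w generalizing i with
  | nil => exact .single ⟨⟨_, _, hij, rfl⟩, ⟨_, _, hkl, rfl⟩, infinite_inter _ _ _⟩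
  | cons hadj _ ih =>
    exact .head ⟨⟨_, _, hij, rfl⟩, ⟨_, _, hadj, rfl⟩, infinite_inter _ _ _⟩ (ih hadj hkl)

theorem isAlgebraicNetwork [Finite ι] [Nontrivial ι] (heven : IsEvenArtin m)
    (hconn : (artinGraph m).Connected) (S : FinGenSet (ArtinGroup m)) :
    IsAlgebraicNetwork S 1 (edgeSubgroups m) where
  finite := by
    refine (Set.finite_range (standardParabolic m)).subset ?_
    rintro _ ⟨i, j, -, rfl⟩
    exact Set.mem_range_self _
  nonempty := by
    obtain ⟨i⟩ := hconn.nonempty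
    obtain ⟨j, hij⟩ := hconn.preconnected.exists_adj_of_nontrivial i
    exact ⟨_, i, j, hij, rfl⟩
  fg := by
    rintro _ ⟨i, j, -, rfl⟩
    exact fg_standardParabolic (Set.toFinite _)
  undistorted := by
    rintro _ ⟨i, j, -, rfl⟩
    obtain ⟨r, hr⟩ := exists_leftInverse_subtype heven {i, j}
    exact isUndistorted_of_leftInverse hr
  exists_finiteIndex := by
    refine ⟨⊤, inferInstance, fun g => ⟨g, Subgroup.mem_top g, ?_⟩, Set.range (gen m),
      Set.finite_range _, closure_range_gen m, ?_⟩
    · exact (dist_self (α := WordSpace S) g).trans_lt one_pos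
    · rintro _ ⟨i, rfl⟩
      obtain ⟨j, hij⟩ := hconn.preconnected.exists_adj_of_nontrivial i
      exact Set.mem_biUnion (x := standardParabolic m {i, j}) ⟨i, j, hij, rfl⟩
        (gen_mem_standardParabolic_pair_left i j)
  thickly_connected := by
    rintro _ ⟨i, j, hij, rfl⟩ _ ⟨k, l, hkl, rfl⟩
    exact reflTransGen_edgeSubgroups (hconn.preconnected j k) hij hkl

end ArtinGroup

theorem mainTheorem12 {ι : Type*} [Finite ι] [Nontrivial ι] (m : CoxeterMatrix ι)
    (heven : IsEvenArtin m) (hconn : (artinGraph m).Connected) :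
    IsAlgThickOfOrderAtMost 1 (ArtinGroup m) := by
  refine ⟨Group.fg_iff.2 ⟨_, ArtinGroup.closure_range_gen m, Set.finite_range _⟩,
    ArtinGroup.edgeSubgroups m,
    fun S => ⟨1, one_pos, ArtinGroup.isAlgebraicNetwork heven hconn S⟩, ?_⟩
  rintro _ ⟨i, j, hij, rfl⟩
  exact ArtinGroup.isUnconstrictedGroup_standardParabolic_pair heven hij
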